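/- Let $a,b:[0,\infty)\to\mathbb R$ be Lebesgue measurable and essentially bounded, and let $g,h:[0,\infty)\to\mathbb R$ be Lebesgue measurable with $g(t)\le t$, $h(t)\le t$ for $t\ge 0$, $\limsup_{t\to\infty}(t-g(t))<\infty$ and $\limsup_{t\to\infty}(t-h(t))<\infty$. Consider the equation $$\ddot x(t)+a(t)\dot x(g(t))+b(t)x(h(t))=0. \qquad (1)$$ For $s\ge 0$, Borel measurable bounded functions $\varphi,\psi:(-\infty,s)\to\mathbb R$ and real numbers $x_0,x_0'$, a solution of (1) with the initial conditions $$x(t)=\varphi(t),\quad \dot x(t)=\psi(t)\quad (t<s),\qquad x(s)=x_0,\quad \dot x(s)=x_0'$$ is a function $x$ whose derivative $\dot x$ is locally absolutely continuous on $[s,\infty)$, which satisfies these conditions (the values of $\dot x$ on $(-\infty,s)$ are prescribed to be $\psi$, independently of $\varphi$) and satisfies (1) for almost every $t\ge s$. Equation (1) is called (uniformly) exponentially stable if there are $M>0$ and $\mu>0$, independent of $s$ and of the initial data, such that every such solution satisfies $$|x(t)|\le M e^{-\mu(t-s)}\Big[\,|x(s)|+|\dot x(s)|+\sup_{r<s}\big(|\varphi(r)|+|\psi(r)|\big)\Big],\qquad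 t\ge s.$$ Suppose that there are $t_0\ge 0$ and $\tau\in\mathbb R$ such that $$\alpha=\inf_{t\ge t_0}a(t)>0,\qquad \beta=\inf_{t\ge t_0}b(t)>0,\qquad B=\sup_{t\ge t_0}b(t),\qquad \alpha^2\ge 4B$$ (infima and suprema being essential ones), and that $g(t)=t$ and $t-h(t)\le\tau$ for all $t\ge t_0$. If $$\tau\left\|\frac ba\right\|_{L_\infty[t_0,\infty)}<1,$$ then equation (1) is exponentially stable. -/

import Mathlib

open MeasureTheory Set Filter

/-- Coefficient assumptions for the equation
`x''(t) + a(t) x'(g(t)) + b(t) x(h(t)) = 0` on `[0, ∞)`: the coefficients `a, b` are Lebesgue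
measurable and essentially bounded, the arguments `g, h` are Lebesgue measurable and retarded,
and the delays have finite upper limits. Only the values on `[0, ∞)` matter. -/
structure DelayAssumptions (a b g h : ℝ → ℝ) : Prop where
  memLp_a : MemLp a ⊤ (volume.restrict (Ici 0))
  memLp_b : MemLp b ⊤ (volume.restrict (Ici 0))
  aemeasurable_g : AEMeasurable g (volume.restrict (Ici 0))
  aemeasurable_h : AEMeasurable h (volume.restrict (Ici 0))
  g_le : ∀ t, 0 ≤ t → g t ≤ t
  h_le : ∀ t, 0 ≤ t → h t ≤ t
  limsup_g : limsup (fun t : ℝ => ((t - g t : ℝ) : EReal)) atTop < ⊤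
  limsup_h : limsup (fun t : ℝ => ((t - h t : ℝ) : EReal)) atTop < ⊤

/-- `x` together with its derivative `y` solves the initial value problem
`x''(t) + a(t) x'(g(t)) + b(t) x(h(t)) = 0` for `t ≥ s`, with `x = φ`, `x' = ψ` on `(-∞, s)` and
`x(s) = x₀`, `x'(s) = x₁`.

The prehistories `φ` and `ψ` are independent data, so on `(-∞, s)` the function `y` is prescribed
and need not be the derivative of `x` there. On `[s, ∞)` it is the (one-sided at `s`) derivative
of `x` and is locally absolutely continuous. -/
structure IsDelaySolution (a b g h : ℝ → ℝ) (s : ℝ) (φ ψ : Iio s → ℝ) (x₀ x₁ : ℝ)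
    (x y : ℝ → ℝ) : Prop where
  history_x : ∀ t : Iio s, x t = φ t
  history_y : ∀ t : Iio s, y t = ψ t
  initial_x : x s = x₀
  initial_y : y s = x₁
  hasDeriv : ∀ t, s ≤ t → HasDerivWithinAt x (y t) (Ici s) t
  locallyAC : ∀ T, s ≤ T → AbsolutelyContinuousOnInterval y s T
  equation : ∀ᵐ t ∂(volume.restrict (Ici s)),
    ∃ z, HasDerivAt y z t ∧ z + a t * y (g t) + b t * x (h t) = 0

/-- Uniform exponential stability of `x''(t) + a(t) x'(g(t)) + b(t) x(h(t)) = 0`: the constants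
`M` and `μ` depend neither on the initial point `s ≥ 0` nor on the initial data, which are
Borel measurable bounded prehistories `φ, ψ` and real numbers `x₀, x₁`. -/
def IsExponentiallyStable (a b g h : ℝ → ℝ) : Prop :=
  ∃ M > 0, ∃ μ > 0, ∀ s : ℝ, 0 ≤ s → ∀ φ ψ : Iio s → ℝ,
    Measurable φ → Measurable ψ → (∃ C, ∀ t, |φ t| ≤ C) → (∃ C, ∀ t, |ψ t| ≤ C) →
    ∀ (x₀ x₁ : ℝ) (x y : ℝ → ℝ), IsDelaySolution a b g h s φ ψ x₀ x₁ x y →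
    ∀ t, s ≤ t →
      |x t| ≤ M * Real.exp (-μ * (t - s)) * (|x₀| + |x₁| + ⨆ r : Iio s, (|φ r| + |ψ r|))

/-! Put `l = α / 2` and `z = x' + l x`. From `t₀` on the equation splits into two scalar equations,
`x' + l x = z` and `z' + (a - l) z = (l (a - l) - b) x + b (x - x(h))`. Here `α² ≥ 4B` gives `b ≤
l²`, and with `a ≥ 2l` the coefficient `l (a - l) - b` is nonnegative. Suppose `|x| ≤ P`. Up to
initial data, `x'' + a x' = -b x(h)` gives `|x'| ≤ ‖b/a‖ P`, hence `|x - x(h)| ≤ κ P` with `κ = τ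
‖b/a‖ < 1`. The right side for `z` is then at most `(l (a - l) - b (1 - κ)) P`. As `b ≥ β` and `a`
is bounded, `|z| ≤ θ l P` and so `|x| ≤ θ P` for some `θ < 1`: a contraction. All inequalities are
strict, so they survive a weight `e^{μt}` with small `μ > 0`; this is `decay_of_small_delay`, built
on `AbsolutelyContinuousOnInterval.exp_mul_abs_le`. A crude bound, `IsDelaySolution.growth_bound`,
covers the initial stretch of length at most `t₀ + τ`. -/

/-! ### Scalar comparison estimates -/

/-- One-sided comparison principle: an absolutely continuous function that starts at or below `c`
and is nonincreasing wherever it exceeds `c` stays at or below `c`. -/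
theorem AbsolutelyContinuousOnInterval.le_of_ae_deriv_nonpos {w : ℝ → ℝ} {σ T c : ℝ}
    (hw : AbsolutelyContinuousOnInterval w σ T) (h₀ : w σ ≤ c)
    (hd : ∀ᵐ t, t ∈ Ioc σ T → c < w t → deriv w t ≤ 0) :
    ∀ t ∈ Icc σ T, w t ≤ c := by
  intro t ht
  by_contra! hlt
  have hcont : ContinuousOn w (Icc σ T) := by
    simpa [uIcc_of_le (ht.1.trans ht.2)] using hw.continuousOn
  have hcont' : ContinuousOn w (Icc σ t) := hcont.mono (Icc_subset_Icc_right ht.2)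
  -- Take the last point `u` of `[σ, t]` with `w u ≤ c`. Beyond it `w > c`, so `w` cannot increase
  -- from `u` to `t`.
  have hS : IsCompact (Icc σ t ∩ w ⁻¹' Iic c) :=
    isCompact_Icc.of_isClosed_subset (hcont'.preimage_isClosed_of_isClosed isClosed_Icc isClosed_Iic)
      inter_subset_left
  obtain ⟨u, ⟨hu, huc⟩, hmax⟩ := hS.exists_isMaxOn ⟨σ, ⟨le_rfl, ht.1⟩, h₀⟩ continuousOn_id
  have huc : w u ≤ c := huc
  have habove : ∀ r ∈ Ioc u t, c < w r := by
    intro r hr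
    by_contra! hrc
    exact (hr.1.trans_le (hmax ⟨⟨hu.1.trans hr.1.le, hr.2⟩, hrc⟩)).false
  have hint := (hw.mono (c := u) (d := t) (by
    rw [uIcc_of_le hu.2, uIcc_of_le (ht.1.trans ht.2)]
    exact Icc_subset_Icc hu.1 ht.2)).integral_deriv_eq_sub
  have hle : ∫ r in u..t, deriv w r ≤ 0 := by
    rw [intervalIntegral.integral_of_le hu.2]
    refine integral_nonpos_of_ae ?_
    rw [EventuallyLE, ae_restrict_iff' measurableSet_Ioc]
    filter_upwards [hd] with r hr hmem
    exact hr ⟨hu.1.trans_lt hmem.1, hmem.2.trans ht.2⟩ (habove r hmem)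
  linarith

/-- Exponentially weighted bound for a scalar linear differential inequality
`|w' + (p + m) w| ≤ p c e^{-m (t - σ)}`. -/
theorem AbsolutelyContinuousOnInterval.exp_mul_abs_le {w p : ℝ → ℝ} {σ T c m : ℝ}
    (hw : AbsolutelyContinuousOnInterval w σ T) (h₀ : |w σ| ≤ c)
    (hd : ∀ᵐ t, t ∈ Ioc σ T → ∃ z, HasDerivAt w z t ∧ 0 ≤ p t ∧
      Real.exp (m * (t - σ)) * |z + (p t + m) * w t| ≤ p t * c) :
    ∀ t ∈ Icc σ T, Real.exp (m * (t - σ)) * |w t| ≤ c := by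
  have hE : ∀ t, HasDerivAt (fun t => Real.exp (m * (t - σ)))
      (Real.exp (m * (t - σ)) * m) t := fun t => by
    simpa using (((hasDerivAt_id t).sub_const σ).const_mul m).exp
  have hEac : AbsolutelyContinuousOnInterval (fun t => Real.exp (m * (t - σ))) σ T := by
    refine ContDiffOn.absolutelyContinuousOnInterval ?_
    fun_prop
  -- The weighted function `v` satisfies `|v' + p v| ≤ p c`, so `v' ≤ p (c - v) ≤ 0` wherever `v >
  -- c`. The same holds for `-v`.
  have hv := hEac.mul hw
  have hσ : (fun t => Real.exp (m * (t - σ)) * w t) σ = w σ := by simp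
  have hvd : ∀ᵐ t, t ∈ Ioc σ T → ∃ z, HasDerivAt (fun t => Real.exp (m * (t - σ)) * w t) z t ∧
      0 ≤ p t ∧ |z + p t * (Real.exp (m * (t - σ)) * w t)| ≤ p t * c := by
    filter_upwards [hd] with t ht hmem
    obtain ⟨z, hz, hp, hb⟩ := ht hmem
    refine ⟨_, (hE t).mul hz, hp, ?_⟩
    refine le_trans (le_of_eq ?_) hb
    rw [← abs_of_pos (Real.exp_pos (m * (t - σ))), ← abs_mul, abs_of_pos (Real.exp_pos _)]
    congr 1
    ring
  have hup := AbsolutelyContinuousOnInterval.le_of_ae_deriv_nonpos (c := c) hv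
    (hσ.le.trans (abs_le.1 h₀).2) (by
      filter_upwards [hvd] with t ht hmem hc
      obtain ⟨z, hz, hp, hb⟩ := ht hmem
      refine le_of_eq_of_le (HasDerivAt.deriv hz) ?_
      have := mul_le_mul_of_nonneg_left (show c ≤ Real.exp (m * (t - σ)) * w t from hc.le) hp
      linarith [(abs_le.1 hb).2])
  have hlow := AbsolutelyContinuousOnInterval.le_of_ae_deriv_nonpos (c := c) hv.neg
    (by have := (abs_le.1 h₀).1; simp; linarith) (by
      filter_upwards [hvd] with t ht hmem hc
      obtain ⟨z, hz, hp, hb⟩ := ht hmem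
      refine le_of_eq_of_le (HasDerivAt.deriv hz.neg) ?_
      have := mul_le_mul_of_nonneg_left
        (show c ≤ -(Real.exp (m * (t - σ)) * w t) from hc.le) hp
      linarith [(abs_le.1 hb).1])
  intro t ht
  have h1 : Real.exp (m * (t - σ)) * w t ≤ c := hup t ht
  have h2 : -(Real.exp (m * (t - σ)) * w t) ≤ c := hlow t ht
  rw [← abs_of_pos (Real.exp_pos (m * (t - σ))), ← abs_mul]
  exact abs_le.2 ⟨by linarith, h1⟩

/-- A function with a continuous one-sided derivative is absolutely continuous. -/
theorem absolutelyContinuousOnInterval_of_hasDerivWithinAt {x y : ℝ → ℝ} {s T : ℝ} (hsT : s ≤ T)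
    (hx : ∀ t, s ≤ t → HasDerivWithinAt x (y t) (Ici s) t) (hy : ContinuousOn y (Icc s T)) :
    AbsolutelyContinuousOnInterval x s T := by
  obtain ⟨C, hC⟩ := isCompact_Icc.exists_bound_of_continuousOn hy
  have hL : LipschitzOnWith C.toNNReal x (uIcc s T) := by
    rw [uIcc_of_le hsT]
    refine (convex_Icc s T).lipschitzOnWith_of_nnnorm_hasDerivWithin_le
      (fun t ht => (hx t ht.1).mono Icc_subset_Ici_self) fun t ht => ?_
    rw [← NNReal.coe_le_coe, coe_nnnorm]
    exact (hC t ht).trans (Real.le_coe_toNNReal C)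
  exact hL.absolutelyContinuousOnInterval

theorem HasDerivWithinAt.hasDerivAt_of_lt {x : ℝ → ℝ} {d s t : ℝ}
    (hx : HasDerivWithinAt x d (Ici s) t) (ht : s < t) : HasDerivAt x d t :=
  hx.hasDerivAt (Ici_mem_nhds ht)

/-! ### The contraction estimate -/

/-- This is the contraction factor for `z`. The gain `β (1 - κ)` pays both for lowering `l` to `θ l`
and for the damping lost to the weight `μ`. -/
theorem mul_sub_add_mul_le {a b A β l μ κ θ : ℝ} (hl : 0 ≤ l) (hμ : 0 ≤ μ) (ha : μ ≤ a)
    (haA : a ≤ A) (hb : β ≤ b) (hκ : κ ≤ 1) (hθ₁ : θ ≤ 1)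
    (hθ : (1 - θ) * (l * A) + μ * A ≤ β * (1 - κ)) :
    l * (a - l) - b + b * κ ≤ (a - l - μ) * (θ * (l - μ)) := by
  have k1 : β * (1 - κ) ≤ b * (1 - κ) := mul_le_mul_of_nonneg_right hb (by linarith)
  have k2 : (1 - θ) * (l * (a - l)) ≤ (1 - θ) * (l * A) :=
    mul_le_mul_of_nonneg_left (mul_le_mul_of_nonneg_left (by linarith) hl) (by linarith)
  have k3 : θ * (μ * (a - μ)) ≤ μ * A :=
    (mul_le_of_le_one_left (mul_nonneg hμ (by linarith)) hθ₁).trans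
      (mul_le_mul_of_nonneg_left (by linarith) hμ)
  have k4 : (a - l - μ) * (θ * (l - μ)) = θ * (l * (a - l)) - θ * (μ * (a - μ)) := by ring
  linarith

/-- Decay of solutions of `x'' + a x' + b x(h) = 0` started at `σ`, given a bound `K` on
`[σ - τ, σ]`. -/
theorem decay_of_small_delay {a b h x y : ℝ → ℝ} {α A β l ρ ρ' τ μ κ θ C K σ : ℝ}
    (hx : ∀ t, σ - τ ≤ t → HasDerivWithinAt x (y t) (Ici (σ - τ)) t)
    (hy : ∀ T, σ - τ ≤ T → AbsolutelyContinuousOnInterval y (σ - τ) T)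
    (heq : ∀ᵐ t, σ < t → ∃ z, HasDerivAt y z t ∧ z + a t * y t + b t * x (h t) = 0)
    (hcoef : ∀ᵐ t, σ < t → α ≤ a t ∧ a t ≤ A ∧ β ≤ b t ∧ b t ≤ l ^ 2 ∧ b t ≤ ρ * a t)
    (hh : ∀ t, σ ≤ t → t - τ ≤ h t ∧ h t ≤ t) (hτ : 0 ≤ τ)
    (hK : ∀ t ∈ Icc (σ - τ) σ, |x t| ≤ K ∧ |y t| ≤ K)
    (hα : α = 2 * l) (hβ : 0 < β) (hμ : 0 < μ) (hμl : μ < l) (hρ : ρ ≤ ρ') (hρ' : 0 < ρ')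
    (hρμ : ρ * α ≤ ρ' * (α - μ)) (hκ : τ * Real.exp (μ * τ) ^ 2 * ρ' ≤ κ) (hκ₁ : κ < 1)
    (hθ₀ : 0 ≤ θ) (hθ₁ : θ < 1) (hθ : (1 - θ) * (l * A) + μ * A ≤ β * (1 - κ))
    (hC₁ : 1 ≤ C) (hCρ : 1 ≤ ρ' * C) (hCl : 1 + l ≤ θ * (l - μ) * C) :
    ∀ t, σ ≤ t → Real.exp (μ * (t - σ)) * |x t| ≤ C * K := by
  intro T hT
  have hl : 0 < l := hμ.trans hμl
  have hsT : σ - τ ≤ T := by linarith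
  have hsσ : σ - τ ≤ σ := by linarith
  have hycont : ContinuousOn y (Icc (σ - τ) T) := by
    simpa [uIcc_of_le hsT] using (hy T hsT).continuousOn
  have hxcont : ContinuousOn x (Icc (σ - τ) T) := fun t ht =>
    ((hx t ht.1).continuousWithinAt).mono Icc_subset_Ici_self
  have hsub : uIcc σ T ⊆ uIcc (σ - τ) T := by
    rw [uIcc_of_le hT, uIcc_of_le hsT]
    exact Icc_subset_Icc_left hsσ
  have hyac := (hy T hsT).mono hsub
  have hxac := (absolutelyContinuousOnInterval_of_hasDerivWithinAt hsT hx hycont).mono hsub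
  have hK₀ : 0 ≤ K := (abs_nonneg _).trans (hK σ ⟨hsσ, le_rfl⟩).1
  -- On a compact interval the weighted maximum `P` is attained, so no boundedness of `x` on the
  -- half-line is presupposed.
  obtain ⟨u, hu, hmax⟩ := isCompact_Icc.exists_isMaxOn (f := fun t => Real.exp (μ * (t - σ)) * |x t|)
    (nonempty_Icc.2 hsT) (by fun_prop)
  set P := Real.exp (μ * (u - σ)) * |x u| with hP
  have hxP : ∀ t ∈ Icc (σ - τ) T, Real.exp (μ * (t - σ)) * |x t| ≤ P := fun t ht => hmax ht
  refine (hxP T ⟨hsT, le_rfl⟩).trans ?_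
  by_contra! hlt
  have hKP : K < P := (le_mul_of_one_le_left hK₀ hC₁).trans_lt hlt
  have hP₀ : 0 < P := hK₀.trans_lt hKP
  set E := Real.exp (μ * τ) with hE
  have hE₁ : 1 ≤ E := Real.one_le_exp (by positivity)
  have hshift : ∀ r t, t - τ ≤ r → Real.exp (μ * (t - σ)) ≤ E * Real.exp (μ * (r - σ)) := by
    intro r t hr
    rw [hE, ← Real.exp_add]
    rw [← mul_add]
    exact Real.exp_le_exp.2 (mul_le_mul_of_nonneg_left (by linarith) hμ.le)
  have hxh : ∀ t ∈ Icc σ T, Real.exp (μ * (t - σ)) * |x (h t)| ≤ E * P := by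
    intro t ht
    obtain ⟨h1, h2⟩ := hh t ht.1
    have h3 := hxP (h t) ⟨by linarith [ht.1], h2.trans ht.2⟩
    calc _ ≤ E * Real.exp (μ * (h t - σ)) * |x (h t)| :=
          mul_le_mul_of_nonneg_right (hshift _ _ h1) (abs_nonneg _)
      _ ≤ E * P := by rw [mul_assoc]; gcongr
  have hKρ : K ≤ ρ' * E * P := by
    have h1 : ρ' * (C * K) ≤ ρ' * P := by gcongr
    have h2 : ρ' * P * 1 ≤ ρ' * P * E := by gcongr
    have h3 := le_mul_of_one_le_left hK₀ hCρ
    linarith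
  have hyQ' : ∀ t ∈ Icc σ T, Real.exp (μ * (t - σ)) * |y t| ≤ ρ' * E * P := by
    refine hyac.exp_mul_abs_le (p := fun t => a t - μ)
      ((hK σ ⟨hsσ, le_rfl⟩).2.trans hKρ) ?_
    filter_upwards [heq, hcoef] with t ht1 ht2 hmem
    obtain ⟨z, hz, hzeq⟩ := ht1 hmem.1
    obtain ⟨ha, haA, hb, hbl, hba⟩ := ht2 hmem.1
    refine ⟨z, hz, by linarith, ?_⟩
    have hz' : z + (a t - μ + μ) * y t = -(b t * x (h t)) := by linarith
    rw [hz', abs_neg, abs_mul, abs_of_pos (hβ.trans_le hb)]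
    have h1 := hxh t ⟨hmem.1.le, hmem.2⟩
    -- Split `ρ a = ρ α + ρ (a - α)`; the first part is at most `ρ' (α - μ)`, the second at most `ρ'
    -- (a - α)`.
    have h2 : b t ≤ (a t - μ) * ρ' := by nlinarith
    calc _ = b t * (Real.exp (μ * (t - σ)) * |x (h t)|) := by ring
      _ ≤ b t * (E * P) := by gcongr; exact (hβ.trans_le hb).le
      _ ≤ (a t - μ) * ρ' * (E * P) := by gcongr
      _ = _ := by ring
  have hyQ : ∀ t ∈ Icc (σ - τ) T, Real.exp (μ * (t - σ)) * |y t| ≤ ρ' * E * P := by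
    intro t ht
    rcases le_total σ t with hσt | hσt
    · exact hyQ' t ⟨hσt, ht.2⟩
    · have h1 : Real.exp (μ * (t - σ)) ≤ 1 := Real.exp_le_one_iff.2 (mul_nonpos_of_nonneg_of_nonpos hμ.le (by linarith))
      have h2 := (hK t ⟨ht.1, hσt⟩).2
      exact (mul_le_of_le_one_left (abs_nonneg _) h1).trans (h2.trans hKρ)
  -- Mean value inequality on `[h t, t]`. One factor `E` comes from the bound on `y`, the other from
  -- moving the weight from `r` to `t`.
  have hD : ∀ t ∈ Icc σ T, Real.exp (μ * (t - σ)) * |x t - x (h t)| ≤ κ * P := by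
    intro t ht
    obtain ⟨h1, h2⟩ := hh t ht.1
    have hs : ∀ r ∈ Icc (h t) t, r ∈ Icc (σ - τ) T := fun r hr =>
      ⟨by linarith [ht.1, hr.1], hr.2.trans ht.2⟩
    set e := Real.exp (μ * (t - σ)) with he
    have he₀ : 0 < e := Real.exp_pos _
    have hb : ∀ r ∈ Icc (h t) t, ‖y r‖ ≤ E * (ρ' * E * P) / e := by
      intro r hr
      rw [le_div_iff₀ he₀, Real.norm_eq_abs]
      calc |y r| * e ≤ |y r| * (E * Real.exp (μ * (r - σ))) := by
            gcongr; exact hshift r t (h1.trans hr.1)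
        _ = E * (Real.exp (μ * (r - σ)) * |y r|) := by ring
        _ ≤ _ := mul_le_mul_of_nonneg_left (hyQ r (hs r hr)) (by positivity)
    have hmv := (convex_Icc (h t) t).norm_image_sub_le_of_norm_hasDerivWithin_le
      (fun r hr => (hx r (hs r hr).1).mono fun q hq => (hs q hq).1) hb
      (left_mem_Icc.2 h2) (right_mem_Icc.2 h2)
    rw [Real.norm_eq_abs, Real.norm_eq_abs, abs_of_nonneg (sub_nonneg.2 h2)] at hmv
    calc e * |x t - x (h t)| ≤ e * (E * (ρ' * E * P) / e * τ) := by
          gcongr; exact hmv.trans (by gcongr; linarith)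
      _ = τ * E ^ 2 * ρ' * P := by field_simp
      _ ≤ κ * P := by gcongr
  have hz : ∀ t ∈ Icc σ T, Real.exp (μ * (t - σ)) * |(y + fun t => l * x t) t| ≤
      θ * (l - μ) * P := by
    refine (hyac.add (hxac.const_mul l)).exp_mul_abs_le (p := fun t => a t - l - μ) ?_ ?_
    · obtain ⟨h1, h2⟩ := hK σ ⟨hsσ, le_rfl⟩
      have h3 : |y σ + l * x σ| ≤ (1 + l) * K := by
        refine (abs_add_le _ _).trans ?_
        rw [abs_mul, abs_of_pos hl]
        nlinarith
      have h4 : θ * (l - μ) * (C * K) ≤ θ * (l - μ) * P :=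
        mul_le_mul_of_nonneg_left hlt.le (mul_nonneg hθ₀ (by linarith))
      have h5 := mul_le_mul_of_nonneg_right hCl hK₀
      simp only [Pi.add_apply]
      linarith
    filter_upwards [heq, hcoef] with t ht1 ht2 hmem
    obtain ⟨z, hz, hzeq⟩ := ht1 hmem.1
    obtain ⟨ha, haA, hb, hbl, hba⟩ := ht2 hmem.1
    have hmem' : t ∈ Icc σ T := ⟨hmem.1.le, hmem.2⟩
    have hxd := (hx t (hsσ.trans hmem.1.le)).hasDerivAt_of_lt (hsσ.trans_lt hmem.1)
    refine ⟨_, hz.add (hxd.const_mul l), by linarith, ?_⟩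
    have hz' : z + l * y t + (a t - l - μ + μ) * (y + fun t => l * x t) t =
        (l * (a t - l) - b t) * x t + b t * (x t - x (h t)) := by
      simp only [Pi.add_apply]
      linear_combination hzeq
    rw [hz']
    have hpos : 0 ≤ l * (a t - l) - b t := by
      have : l * l ≤ l * (a t - l) := by gcongr; linarith
      linarith [sq l]
    have hbpos : 0 < b t := hβ.trans_le hb
    have h1 := hxP t ⟨hsσ.trans hmem.1.le, hmem.2⟩
    have h2 := hD t hmem'
    have hkey : l * (a t - l) - b t + b t * κ ≤ (a t - l - μ) * (θ * (l - μ)) :=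
      mul_sub_add_mul_le hl.le hμ.le (by linarith) haA hb hκ₁.le hθ₁.le hθ
    calc _ ≤ Real.exp (μ * (t - σ)) *
          ((l * (a t - l) - b t) * |x t| + b t * |x t - x (h t)|) := by
          gcongr
          refine (abs_add_le _ _).trans ?_
          rw [abs_mul, abs_mul, abs_of_nonneg hpos, abs_of_pos hbpos]
      _ = (l * (a t - l) - b t) * (Real.exp (μ * (t - σ)) * |x t|) +
          b t * (Real.exp (μ * (t - σ)) * |x t - x (h t)|) := by ring
      _ ≤ (l * (a t - l) - b t) * P + b t * (κ * P) := by gcongr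
      _ = (l * (a t - l) - b t + b t * κ) * P := by ring
      _ ≤ (a t - l - μ) * (θ * (l - μ)) * P := by gcongr
      _ = _ := by ring
  -- Integrating `x' + l x = z` returns a bound on `x` with the factor `θ`; `K` accounts for the
  -- value at `σ`.
  have hxc : ∀ t ∈ Icc σ T, Real.exp (μ * (t - σ)) * |x t| ≤ max (θ * P) K := by
    refine hxac.exp_mul_abs_le (p := fun _ => l - μ)
      ((hK σ ⟨hsσ, le_rfl⟩).1.trans (le_max_right _ _)) (ae_of_all _ fun t hmem => ?_)
    have hxd := (hx t (hsσ.trans hmem.1.le)).hasDerivAt_of_lt (hsσ.trans_lt hmem.1)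
    refine ⟨_, hxd, by linarith, ?_⟩
    have h1 := hz t ⟨hmem.1.le, hmem.2⟩
    simp only [Pi.add_apply] at h1
    rw [sub_add_cancel]
    have h2 : (l - μ) * (θ * P) ≤ (l - μ) * max (θ * P) K := by
      have : 0 ≤ l - μ := by linarith
      gcongr; exact le_max_left _ _
    linarith
  rcases le_total σ u with hσu | hσu
  · have h1 : P ≤ max (θ * P) K := hxc u ⟨hσu, hu.2⟩
    have h2 : θ * P < P := mul_lt_of_lt_one_left hP₀ hθ₁
    exact absurd h1 (not_le.2 (max_lt h2 hKP))
  · have h1 : Real.exp (μ * (u - σ)) ≤ 1 := Real.exp_le_one_iff.2 (mul_nonpos_of_nonneg_of_nonpos hμ.le (by linarith))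
    have h2 := (hK u ⟨hu.1, hσu⟩).1
    have h3 : P ≤ K := (mul_le_of_le_one_left (abs_nonneg _) h1).trans h2
    linarith

/-! ### Growth on bounded time intervals -/

/-- A priori exponential growth bound for solutions with bounded coefficients. -/
theorem IsDelaySolution.growth_bound {a b g h x y : ℝ → ℝ} {s x₀ x₁ N L : ℝ} {φ ψ : Iio s → ℝ}
    (hsol : IsDelaySolution a b g h s φ ψ x₀ x₁ x y) (hs : 0 ≤ s)
    (hgle : ∀ t, 0 ≤ t → g t ≤ t) (hhle : ∀ t, 0 ≤ t → h t ≤ t) (hL : 1 ≤ L)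
    (hcoef : ∀ᵐ t, 0 ≤ t → |a t| ≤ L ∧ |b t| ≤ L)
    (hφ : ∀ r, |φ r| ≤ N) (hψ : ∀ r, |ψ r| ≤ N) (hx₀ : |x₀| ≤ N) (hx₁ : |x₁| ≤ N) :
    ∀ t, s ≤ t → |x t| + |y t| ≤ 2 * N * Real.exp (8 * L * (t - s)) := by
  intro T hT
  have hycont : ContinuousOn y (Icc s T) := by
    simpa [uIcc_of_le hT] using (hsol.locallyAC T hT).continuousOn
  have hxcont : ContinuousOn x (Icc s T) := fun t ht =>
    ((hsol.hasDeriv t ht.1).continuousWithinAt).mono Icc_subset_Ici_self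
  have hxac := absolutelyContinuousOnInterval_of_hasDerivWithinAt hT hsol.hasDeriv hycont
  have hN₀ : 0 ≤ N := (abs_nonneg _).trans hx₀
  have hxs : |x s| ≤ N := by rw [hsol.initial_x]; exact hx₀
  have hys : |y s| ≤ N := by rw [hsol.initial_y]; exact hx₁
  obtain ⟨u, hu, hmax⟩ := isCompact_Icc.exists_isMaxOn
    (f := fun t => Real.exp (-(8 * L) * (t - s)) * (|x t| + |y t|))
    (nonempty_Icc.2 hT) (by fun_prop)
  set P := Real.exp (-(8 * L) * (u - s)) * (|x u| + |y u|) with hP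
  have hle : ∀ t ∈ Icc s T, Real.exp (-(8 * L) * (t - s)) * (|x t| + |y t|) ≤ P :=
    fun t ht => hmax ht
  have hmain : P ≤ 2 * N := by
    by_contra! hlt
    -- The weight decreases in time, so earlier values are controlled by `P`; on the prehistory the
    -- weight is at most `1` and `N < P`.
    have hpast : ∀ t ∈ Icc s T, ∀ r ≤ t,
        Real.exp (-(8 * L) * (t - s)) * |x r| ≤ P ∧ Real.exp (-(8 * L) * (t - s)) * |y r| ≤ P := by
      intro t ht r hr
      rcases lt_or_ge r s with hrs | hrs
      · have h1 : Real.exp (-(8 * L) * (t - s)) ≤ 1 :=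
          Real.exp_le_one_iff.2 (by nlinarith [ht.1])
        have h2 : |x r| ≤ N := by rw [hsol.history_x ⟨r, hrs⟩]; exact hφ _
        have h3 : |y r| ≤ N := by rw [hsol.history_y ⟨r, hrs⟩]; exact hψ _
        constructor <;> nlinarith [abs_nonneg (x r), abs_nonneg (y r)]
      · have h1 : Real.exp (-(8 * L) * (t - s)) ≤ Real.exp (-(8 * L) * (r - s)) :=
          Real.exp_le_exp.2 (by nlinarith)
        have h2 := hle r ⟨hrs, hr.trans ht.2⟩
        have h3 := mul_le_mul_of_nonneg_right h1 (abs_nonneg (x r))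
        have h4 := mul_le_mul_of_nonneg_right h1 (abs_nonneg (y r))
        have h5 := mul_nonneg (Real.exp_pos (-(8 * L) * (r - s))).le (abs_nonneg (x r))
        have h6 := mul_nonneg (Real.exp_pos (-(8 * L) * (r - s))).le (abs_nonneg (y r))
        constructor <;> nlinarith
    -- With `p = 8L` and `m = -8L` the linear term vanishes. The right side is at most `2LP = 8L
    -- (P/4)`, which makes `P ≤ 2 max(N, P/4)` contradict `P > 2N`.
    have hyb : ∀ t ∈ Icc s T, Real.exp (-(8 * L) * (t - s)) * |y t| ≤ max N (P / 4) := by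
      refine (hsol.locallyAC T hT).exp_mul_abs_le (p := fun _ => 8 * L)
        (hys.trans (le_max_left _ _)) ?_
      have heq := hsol.equation
      rw [ae_restrict_iff' measurableSet_Ici] at heq
      filter_upwards [heq, hcoef] with t ht1 ht2 hmem
      obtain ⟨z, hz, hzeq⟩ := ht1 hmem.1.le
      have ht₀ : 0 ≤ t := hs.trans hmem.1.le
      obtain ⟨ha, hb⟩ := ht2 ht₀
      refine ⟨z, hz, by linarith, ?_⟩
      have hmem' : t ∈ Icc s T := ⟨hmem.1.le, hmem.2⟩
      have h1 := (hpast t hmem' _ (hgle t ht₀)).2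
      have h2 := (hpast t hmem' _ (hhle t ht₀)).1
      have hz' : z + (8 * L + -(8 * L)) * y t = -(a t * y (g t) + b t * x (h t)) := by linarith
      rw [hz', abs_neg]
      calc _ ≤ Real.exp (-(8 * L) * (t - s)) * (L * |y (g t)| + L * |x (h t)|) := by
            gcongr
            refine (abs_add_le _ _).trans ?_
            rw [abs_mul, abs_mul]
            gcongr
        _ = L * (Real.exp (-(8 * L) * (t - s)) * |y (g t)|) +
            L * (Real.exp (-(8 * L) * (t - s)) * |x (h t)|) := by ring
        _ ≤ L * P + L * P := by gcongr
        _ = 8 * L * (P / 4) := by ring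
        _ ≤ 8 * L * max N (P / 4) := by gcongr; exact le_max_right _ _
    have hxb : ∀ t ∈ Icc s T, Real.exp (-(8 * L) * (t - s)) * |x t| ≤ max N (P / 4) := by
      refine hxac.exp_mul_abs_le (p := fun _ => 8 * L)
        (hxs.trans (le_max_left _ _)) (ae_of_all _ fun t hmem => ?_)
      refine ⟨_, (hsol.hasDeriv t hmem.1.le).hasDerivAt_of_lt hmem.1, by linarith, ?_⟩
      have h1 := (hpast t ⟨hmem.1.le, hmem.2⟩ t le_rfl).2
      have h2 : P / 4 ≤ max N (P / 4) := le_max_right _ _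
      rw [add_neg_cancel, zero_mul, add_zero]
      nlinarith
    have h1 := hyb u hu
    have h2 := hxb u hu
    have h3 : P ≤ 2 * max N (P / 4) := by
      have : P = Real.exp (-(8 * L) * (u - s)) * |x u| + Real.exp (-(8 * L) * (u - s)) * |y u| :=
        mul_add _ _ _
      linarith
    rcases max_cases N (P / 4) with ⟨h4, _⟩ | ⟨h4, _⟩ <;> rw [h4] at h3 <;> linarith
  have h1 := (hle T ⟨hT, le_rfl⟩).trans hmain
  calc |x T| + |y T| = Real.exp (-(8 * L) * (T - s)) * (|x T| + |y T|) *
        Real.exp (8 * L * (T - s)) := by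
        rw [mul_right_comm, ← Real.exp_add]
        simp
    _ ≤ _ := by gcongr

/-! ### Choice of constants -/

/-- Choice of the decay rate and of the contraction constants. -/
theorem exists_decay_constants {A β l ρ τ : ℝ} (hA : 0 < A) (hβ : 0 < β) (hl : 0 < l)
    (hρ : 0 ≤ ρ) (hτ : 0 ≤ τ) (hτρ : τ * ρ < 1) :
    ∃ ρ' μ κ θ C : ℝ, 0 < μ ∧ μ < l ∧ ρ ≤ ρ' ∧ 0 < ρ' ∧
      ρ * (2 * l) ≤ ρ' * (2 * l - μ) ∧ τ * Real.exp (μ * τ) ^ 2 * ρ' ≤ κ ∧ κ < 1 ∧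
      0 ≤ θ ∧ θ < 1 ∧ (1 - θ) * (l * A) + μ * A ≤ β * (1 - κ) ∧
      1 ≤ C ∧ 1 ≤ ρ' * C ∧ 1 + l ≤ θ * (l - μ) * C := by
  obtain ⟨ρ', hρρ', hτρ'⟩ : ∃ ρ', ρ < ρ' ∧ τ * ρ' < 1 := by
    refine ⟨ρ + (1 - τ * ρ) / (2 * (τ + 1)), ?_, ?_⟩
    · have : 0 < (1 - τ * ρ) / (2 * (τ + 1)) := div_pos (by linarith) (by linarith)
      linarith
    · have h1 : τ * ((1 - τ * ρ) / (2 * (τ + 1))) ≤ (1 - τ * ρ) / 2 := by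
        rw [mul_div_assoc', div_le_div_iff₀ (by linarith) (by norm_num)]
        nlinarith
      linarith
  obtain ⟨κ, hκ, hκ₁⟩ := exists_between hτρ'
  have hρ' : 0 < ρ' := hρ.trans_lt hρρ'
  have hδ : 0 < β * (1 - κ) / 2 := by
    have := mul_pos hβ (sub_pos.2 hκ₁)
    linarith
  obtain ⟨μ, h1, h2, h3, h4, hμ⟩ : ∃ μ : ℝ, μ < l ∧ ρ * (2 * l) < ρ' * (2 * l - μ) ∧
      τ * Real.exp (μ * τ) ^ 2 * ρ' < κ ∧ μ * A < β * (1 - κ) / 2 ∧ 0 < μ := by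
    -- Each inequality is strict at `μ = 0`, hence holds for small `μ > 0` by continuity.
    have e1 : ∀ᶠ μ : ℝ in nhds 0, μ < l := gt_mem_nhds hl
    have e2 : ∀ᶠ μ : ℝ in nhds 0, ρ * (2 * l) < ρ' * (2 * l - μ) := by
      refine ContinuousAt.eventually_lt (by fun_prop) (by fun_prop) ?_
      nlinarith
    have e3 : ∀ᶠ μ : ℝ in nhds 0, τ * Real.exp (μ * τ) ^ 2 * ρ' < κ := by
      refine ContinuousAt.eventually_lt (by fun_prop) (by fun_prop) ?_
      simpa using hκ
    have e4 : ∀ᶠ μ : ℝ in nhds 0, μ * A < β * (1 - κ) / 2 := by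
      refine ContinuousAt.eventually_lt (by fun_prop) (by fun_prop) ?_
      simpa using hδ
    have hall := (e1.and (e2.and (e3.and e4))).filter_mono (nhdsWithin_le_nhds (s := Ioi 0))
    obtain ⟨μ, ⟨k1, k2, k3, k4⟩, k5⟩ := (hall.and self_mem_nhdsWithin).exists
    exact ⟨μ, k1, k2, k3, k4, k5⟩
  have hlA : 0 < l * A := mul_pos hl hA
  -- Half of the budget `β (1 - κ)` went to `μ A`; the other half pays for `ε l A`, where `θ = 1 -
  -- ε`.
  set ε := min (1 / 2) (β * (1 - κ) / 2 / (l * A)) with hε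
  have hε₀ : 0 < ε := lt_min (by norm_num) (div_pos hδ hlA)
  have hε₁ : ε ≤ 1 / 2 := min_le_left _ _
  have hεA : ε * (l * A) ≤ β * (1 - κ) / 2 := by
    rw [← le_div_iff₀ hlA]
    exact min_le_right _ _
  have hθl : 0 < (1 - ε) * (l - μ) := mul_pos (by linarith) (by linarith)
  refine ⟨ρ', μ, κ, 1 - ε, max 1 (max (1 / ρ') ((1 + l) / ((1 - ε) * (l - μ)))), hμ, h1, hρρ'.le,
    hρ', h2.le, h3.le, hκ₁, by linarith, by linarith, ?_, le_max_left _ _, ?_, ?_⟩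
  · rw [sub_sub_cancel]
    linarith
  · rw [← div_le_iff₀' hρ']
    exact (le_max_left _ _).trans (le_max_right _ _)
  · rw [← div_le_iff₀' hθl]
    exact (le_max_right _ _).trans (le_max_right _ _)

/-! ### Essential bounds of the coefficients -/

/-- The coefficients have a common almost-everywhere bound. -/
theorem DelayAssumptions.ae_abs_le {a b g h : ℝ → ℝ} (H : DelayAssumptions a b g h) :
    ∃ L, 1 ≤ L ∧ ∀ᵐ t, 0 ≤ t → |a t| ≤ L ∧ |b t| ≤ L := by
  have hbd : ∀ f : ℝ → ℝ, MemLp f ⊤ (volume.restrict (Ici 0)) →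
      ∀ᵐ t, (0 : ℝ) ≤ t → |f t| ≤ (eLpNorm f ⊤ (volume.restrict (Ici 0))).toReal := by
    intro f hf
    have h1 := ae_le_eLpNormEssSup (f := f) (μ := volume.restrict (Ici (0 : ℝ)))
    rw [ae_restrict_iff' measurableSet_Ici] at h1
    filter_upwards [h1] with t ht h0
    have h2 := ENNReal.toReal_mono hf.2.ne ((ht h0).trans_eq eLpNorm_exponent_top.symm)
    simpa using h2
  refine ⟨_, le_max_left 1 (max (eLpNorm a ⊤ (volume.restrict (Ici 0))).toReal
    (eLpNorm b ⊤ (volume.restrict (Ici 0))).toReal), ?_⟩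
  filter_upwards [hbd a H.memLp_a, hbd b H.memLp_b] with t h1 h2 h0
  exact ⟨(h1 h0).trans ((le_max_left _ _).trans (le_max_right _ _)),
    (h2 h0).trans ((le_max_right _ _).trans (le_max_right _ _))⟩

/-- The bound `L` is needed because real-valued `essInf` and `essSup` are genuine a.e. bounds only
for essentially bounded functions. -/
theorem ae_essInf_le_and_le_essSup_of_abs_le {f : ℝ → ℝ} {t₀ L : ℝ} (ht₀ : 0 ≤ t₀)
    (hf : ∀ᵐ t, 0 ≤ t → |f t| ≤ L) :
    ∀ᵐ t, t₀ ≤ t → essInf f (volume.restrict (Ici t₀)) ≤ f t ∧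
      f t ≤ essSup f (volume.restrict (Ici t₀)) := by
  have hf' : ∀ᵐ t ∂(volume.restrict (Ici t₀)), |f t| ≤ L := by
    rw [ae_restrict_iff' measurableSet_Ici]
    filter_upwards [hf] with t ht h0
    exact ht (ht₀.trans h0)
  have h1 : IsBoundedUnder (· ≥ ·) (ae (volume.restrict (Ici t₀))) f :=
    ⟨-L, eventually_map.2 (hf'.mono fun t ht => (abs_le.1 ht).1)⟩
  have h2 : IsBoundedUnder (· ≤ ·) (ae (volume.restrict (Ici t₀))) f :=
    ⟨L, eventually_map.2 (hf'.mono fun t ht => (abs_le.1 ht).2)⟩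
  have h3 := (ae_essInf_le h1).and (ae_le_essSup h2)
  rwa [ae_restrict_iff' measurableSet_Ici] at h3

theorem exists_ratio_bound {a b : ℝ → ℝ} {t₀ τ α L : ℝ} (hα : 0 < α) (hL : 1 ≤ L) (hτ₀ : 0 ≤ τ)
    (hτ : ENNReal.ofReal τ * eLpNorm (fun t => b t / a t) ⊤ (volume.restrict (Ici t₀)) < 1)
    (hab : ∀ᵐ t, t₀ ≤ t → α ≤ a t ∧ b t ≤ L) :
    ∃ ρ, 0 ≤ ρ ∧ τ * ρ < 1 ∧ ∀ᵐ t, t₀ ≤ t → b t ≤ ρ * a t := by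
  -- Only an upper bound on `b` is assumed here, so the norm may be infinite; then `hτ` forces `τ =
  -- 0` and any finite ratio serves.
  by_cases hN : eLpNorm (fun t => b t / a t) ⊤ (volume.restrict (Ici t₀)) = ⊤
  · have hτ' : τ = 0 := by
      refine le_antisymm (not_lt.1 fun h => ?_) hτ₀
      rw [hN, ENNReal.mul_top (ENNReal.ofReal_pos.2 h).ne'] at hτ
      exact not_top_lt hτ
    refine ⟨L / α, by positivity, by simp [hτ'], ?_⟩
    filter_upwards [hab] with t ht h0
    obtain ⟨h1, h2⟩ := ht h0
    calc b t ≤ L / α * α := by rw [div_mul_cancel₀ _ hα.ne']; exact h2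
      _ ≤ L / α * a t := by gcongr
  · refine ⟨_, ENNReal.toReal_nonneg
      (a := eLpNorm (fun t => b t / a t) ⊤ (volume.restrict (Ici t₀))), ?_, ?_⟩
    · have h1 := ENNReal.toReal_strict_mono ENNReal.one_ne_top hτ
      rwa [ENNReal.toReal_mul, ENNReal.toReal_ofReal hτ₀, ENNReal.toReal_one] at h1
    · have h1 := ae_le_eLpNormEssSup (f := fun t => b t / a t) (μ := volume.restrict (Ici t₀))
      rw [ae_restrict_iff' measurableSet_Ici] at h1
      filter_upwards [h1, hab] with t ht hat h0
      have h2 := ENNReal.toReal_mono hN ((ht h0).trans_eq eLpNorm_exponent_top.symm)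
      rw [toReal_enorm, Real.norm_eq_abs] at h2
      rw [← div_le_iff₀ (hα.trans_le (hat h0).1)]
      exact (le_abs_self _).trans h2

/-! ### Exponential stability -/

theorem corollary6 (a b g h : ℝ → ℝ) (H : DelayAssumptions a b g h) (t₀ τ : ℝ) (ht₀ : 0 ≤ t₀)
    (ha : 0 < essInf a (volume.restrict (Ici t₀)))
    (hb : 0 < essInf b (volume.restrict (Ici t₀)))
    (hab : 4 * essSup b (volume.restrict (Ici t₀)) ≤ essInf a (volume.restrict (Ici t₀)) ^ 2)
    (hg : ∀ t, t₀ ≤ t → g t = t)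
    (hh : ∀ t, t₀ ≤ t → t - h t ≤ τ)
    (hτ : ENNReal.ofReal τ * eLpNorm (fun t => b t / a t) ⊤ (volume.restrict (Ici t₀)) < 1) :
    IsExponentiallyStable a b g h := by
  obtain ⟨L, hL, hcoef⟩ := H.ae_abs_le
  have hτ₀ : 0 ≤ τ := by linarith [hh t₀ le_rfl, H.h_le t₀ ht₀]
  have haI := ae_essInf_le_and_le_essSup_of_abs_le ht₀
    (hcoef.mono fun t ht h0 => (ht h0).1)
  have hbI := ae_essInf_le_and_le_essSup_of_abs_le ht₀
    (hcoef.mono fun t ht h0 => (ht h0).2)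
  set α := essInf a (volume.restrict (Ici t₀))
  set β := essInf b (volume.restrict (Ici t₀))
  set B := essSup b (volume.restrict (Ici t₀))
  obtain ⟨ρ, hρ₀, hτρ, hρ⟩ := exists_ratio_bound ha hL hτ₀ hτ (by
    filter_upwards [haI, hcoef] with t h1 h2 h0
    exact ⟨(h1 h0).1, (le_abs_self _).trans (h2 (ht₀.trans h0)).2⟩)
  obtain ⟨ρ', μ, κ, θ, C, hμ, hμl, hρρ', hρ', hρμ, hκ, hκ₁, hθ₀, hθ₁, hθ, hC₁, hCρ, hCl⟩ :=
    exists_decay_constants (A := L) (β := β) (l := α / 2) (by linarith) hb (by linarith)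
      hρ₀ hτ₀ hτρ
  have hR : 0 ≤ t₀ + τ := by linarith
  refine ⟨C * (2 * Real.exp (8 * L * (t₀ + τ))) * Real.exp (μ * (t₀ + τ)), by positivity, μ, hμ, ?_⟩
  intro s hs φ ψ _ _ ⟨c₁, hc₁⟩ ⟨c₂, hc₂⟩ x₀ x₁ x y hsol t ht
  have hbdd : BddAbove (range fun r : Iio s => |φ r| + |ψ r|) :=
    ⟨c₁ + c₂, by rintro _ ⟨r, rfl⟩; exact add_le_add (hc₁ r) (hc₂ r)⟩
  have hS : ∀ r : Iio s, |φ r| + |ψ r| ≤ ⨆ r : Iio s, (|φ r| + |ψ r|) := le_ciSup hbdd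
  set S := ⨆ r : Iio s, (|φ r| + |ψ r|)
  set N := |x₀| + |x₁| + S
  have hS₀ : 0 ≤ S :=
    (add_nonneg (abs_nonneg _) (abs_nonneg _)).trans (hS ⟨s - 1, by simp⟩)
  have hN₀ : 0 ≤ N := by positivity
  have hgrow := hsol.growth_bound (N := N) hs H.g_le H.h_le hL hcoef
    (fun r => by have := hS r; have := abs_nonneg (ψ r); have := abs_nonneg x₀
                 have := abs_nonneg x₁; linarith)
    (fun r => by have := hS r; have := abs_nonneg (φ r); have := abs_nonneg x₀
                 have := abs_nonneg x₁; linarith)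
    (by have := abs_nonneg x₁; linarith) (by have := abs_nonneg x₀; linarith)
  -- Starting `τ` after `max s t₀` keeps `h t` in `[σ - τ, t]` for `t ≥ σ`. There `y` is truly the
  -- derivative of `x`, and the independent prehistories no longer enter.
  set σ := max s t₀ + τ with hσ
  have hsσ : s ≤ σ - τ := by rw [hσ, add_sub_cancel_right]; exact le_max_left _ _
  have htσ : t₀ ≤ σ - τ := by rw [hσ, add_sub_cancel_right]; exact le_max_right _ _
  have hσs : σ ≤ s + (t₀ + τ) := by
    have : max s t₀ ≤ s + t₀ := max_le (by linarith) (by linarith)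
    linarith
  set K := 2 * Real.exp (8 * L * (t₀ + τ)) * N with hK
  have hK₀ : 0 ≤ K := by positivity
  have hKb : ∀ r ∈ Icc s σ, |x r| + |y r| ≤ K := by
    intro r hr
    refine (hgrow r hr.1).trans ?_
    rw [hK, mul_right_comm]
    gcongr
    linarith [hr.2]
  have hfinal : Real.exp (μ * (t - σ)) * |x t| ≤ C * K := by
    rcases le_total σ t with hσt | hσt
    · refine decay_of_small_delay (a := a) (b := b) (h := h) (y := y) (A := L) (ρ := ρ)
        (l := α / 2) (α := α) (τ := τ) ?_ ?_ ?_ ?_ ?_ hτ₀ ?_ (by ring) hb hμ hμl hρρ' hρ'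
        (by linarith) hκ hκ₁ hθ₀ hθ₁ hθ hC₁ hCρ hCl t hσt
      · exact fun r hr => (hsol.hasDeriv r (hsσ.trans hr)).mono (Ici_subset_Ici.2 hsσ)
      · intro T hT
        refine (hsol.locallyAC T (hsσ.trans hT)).mono ?_
        rw [uIcc_of_le hT, uIcc_of_le (hsσ.trans hT)]
        exact Icc_subset_Icc_left hsσ
      · have heq := hsol.equation
        rw [ae_restrict_iff' measurableSet_Ici] at heq
        filter_upwards [heq] with r hr hσr
        have hr' := hr (show s ≤ r by linarith)
        rwa [hg r (by linarith)] at hr'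
      · filter_upwards [haI, hbI, hcoef, hρ] with r h1 h2 h3 h4 hσr
        have hr : t₀ ≤ r := by linarith
        refine ⟨(h1 hr).1, (le_abs_self _).trans (h3 (ht₀.trans hr)).1, (h2 hr).1, ?_, h4 hr⟩
        have := (h2 hr).2
        linarith [show (α / 2) ^ 2 = α ^ 2 / 4 by ring]
      · intro r hr
        exact ⟨by linarith [hh r (by linarith)], H.h_le r (by linarith)⟩
      · intro r hr
        have h1 := hKb r ⟨hsσ.trans hr.1, hr.2⟩
        exact ⟨by linarith [abs_nonneg (y r)], by linarith [abs_nonneg (x r)]⟩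
    · have h1 := hKb t ⟨ht, hσt⟩
      have h2 : Real.exp (μ * (t - σ)) ≤ 1 := Real.exp_le_one_iff.2 (by nlinarith)
      nlinarith [abs_nonneg (x t), abs_nonneg (y t)]
  -- Moving the origin of the weight from `σ` to `s` costs `e^{μ(σ - s)}`, bounded uniformly in `s`
  -- since `σ - s ≤ t₀ + τ`.
  calc |x t| = Real.exp (μ * (σ - s)) * Real.exp (-μ * (t - s)) *
        (Real.exp (μ * (t - σ)) * |x t|) := by
        rw [← mul_assoc, ← Real.exp_add, ← Real.exp_add,
          show μ * (σ - s) + -μ * (t - s) + μ * (t - σ) = 0 by ring]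
        simp
    _ ≤ Real.exp (μ * (t₀ + τ)) * Real.exp (-μ * (t - s)) * (C * K) := by
        gcongr
        linarith
    _ = _ := by rw [hK]; ring
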